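/- **Setting.** Let the sample space and the parameter space of a network be standard Borel spaces, let $\mathrm L(\Theta,\mathbf z)\in\mathbb R$ be the loss at the sample $\mathbf z$ of the network with parameters $\Theta$, assumed jointly measurable, let $e\in\mathbb R$ be an error threshold, $q\ge 2$, and let $0\le c<\tfrac12$ be a clipping level ($c=0$: no clipping). Put $\beta(\mathbf z;\Theta)=+1$ (easy) if $\mathrm L(\Theta,\mathbf z)\le e$ and $\beta(\mathbf z;\Theta)=-1$ (hard) otherwise. Given a training set $(\mathbf z^{(1)},\dots,\mathbf z^{(N)})$, $N\ge 1$, and network parameters $\Theta_1,\Theta_2,\dots$ at the successive epochs, the APW method puts $w_0^{(n)}=\frac1N$ and, for $k\ge 1$, with $\beta_k=\beta(\cdot\,;\Theta_k)$, $$\rho_k=\max\Big\{c,\min\Big\{1-c,\sum_{n:\,\beta_k(\mathbf z^{(n)})=-1}w_{k-1}^{(n)}\Big\}\Big\},\qquad \alpha_k=\frac1q\log\frac{1-\rho_k}{\rho_k},\qquad w_k^{(n)}=\frac{w_{k-1}^{(n)}\exp(-\alpha_k\beta_k(\mathbf z^{(n)}))}{\sum_{i=1}^N w_{k-1}^{(i)}\exp(-\alpha_k\beta_k(\mathbf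 z^{(i)}))}.$$ Write $A_K=\sum_{k=1}^K\alpha_k$ and $g_K(\mathbf z)=\sum_{k=1}^K\alpha_k\beta_k(\mathbf z)$ for every sample $\mathbf z$. The epochs $K+1,\dots,K+\Delta_K$ are a $\Delta_K$-convergence phase of the run if $\rho_k<\frac12$ for $k=K+1,\dots,K+\Delta_K$. Fix $N\ge1$, $K\ge 0$, $\Delta_K\ge 1$ and a measurable set $\mathcal W$ of parameters. Let $\mathcal B$ be the class of all functions $$b(\mathbf z)=\frac{g_{K+\Delta_K}(\mathbf z)-g_K(\mathbf z)}{A_{K+\Delta_K}-A_K}$$ that arise from a training set of size $N$ and parameters $\Theta_k\in\mathcal W$ such that $0<\rho_k<1$ for $1\le k\le K+\Delta_K$ and the epochs $K+1,\dots,K+\Delta_K$ are a $\Delta_K$-convergence phase. For a class $\mathcal F$ of real functions on the sample space, a class $\widehat{\mathcal F}$ of real functions is an $\epsilon$-sloppy $\vartheta$-cover of $\mathcal F$ with respect to a finite sample $S$ if for every $f\in\mathcal F$ there is $\widehat f\in\widehat{\mathcal F}$ with $\mathbb P_{\mathbf z\sim S}[|\widehat f(\mathbf z)-f(\mathbf z)|>\vartheta]<\epsilon$,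 where $\mathbf z\sim S$ means drawn uniformly from $S$. Let $\mathcal N(\mathcal F,\vartheta,\epsilon,m)$ be the maximum, over all samples $S$ of size $m$, of the size of the smallest $\epsilon$-sloppy $\vartheta$-cover of $\mathcal F$ with respect to $S$. **Theorem (Generalization Performance).** Let $\mathcal Z$ be a training set of $N$ i.i.d. samples from a probability distribution $\mathcal D$ on the sample space. Then for all $\varepsilon>0$ and $\theta>0$, with probability at least $$1-2\,\mathcal N\Big(\mathcal B,\frac\theta2,\frac\varepsilon8,2N\Big)\exp\Big(-\frac{\varepsilon^2N}{32}\Big)$$ over the choice of $\mathcal Z$, every $b\in\mathcal B$ satisfies $$\mathbb P_{\mathbf z\sim\mathcal D}[b(\mathbf z)\le 0]\le\mathbb P_{\mathbf z\sim\mathcal Z}[b(\mathbf z)\le\theta]+\varepsilon .$$ -/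

import Mathlib

open MeasureTheory
open scoped ENNReal

noncomputable section

namespace APW

/-- The data of the adaptively point-weighting method: the loss `loss Θ z` of the network with
parameters `Θ` at the sample `z`, the error threshold `e`, the smoothing constant `q` and the
level `c` at which the training difficulty is clipped (`c = 0` means that it is not clipped). -/
structure Config (Param Sample : Type*) where
  loss : Param → Sample → ℝ
  e : ℝ
  q : ℝ
  c : ℝ

variable {Param Sample : Type*} {N : ℕ}

/-- The easy/hard indicator: `+1` if the loss is at most `e` (easy) and `-1` otherwise (hard). -/
def beta (cfg : Config Param Sample) (Θ : Param) (z : Sample) : ℝ :=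
  if cfg.loss Θ z ≤ cfg.e then 1 else -1

/-- The total weight, for given sample weights `w`, of the hard samples of the training set `S`
at the parameters `Θ`, clipped to `[c, 1 - c]`. -/
def difficulty (cfg : Config Param Sample) (S : Fin N → Sample) (Θ : Param) (w : Fin N → ℝ) : ℝ :=
  max cfg.c (min (1 - cfg.c) (∑ n with beta cfg Θ (S n) = -1, w n))

/-- The weight-change value that belongs to a training difficulty `ρ`. -/
def weightChange (q ρ : ℝ) : ℝ := 1 / q * Real.log ((1 - ρ) / ρ)

/-- One update of the sample weights, at an epoch that begins with the parameters `Θ`. -/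
def updateWeights (cfg : Config Param Sample) (S : Fin N → Sample) (Θ : Param) (w : Fin N → ℝ) :
    Fin N → ℝ := fun n =>
  w n * Real.exp (-(weightChange cfg.q (difficulty cfg S Θ w) * beta cfg Θ (S n))) /
    ∑ i, w i * Real.exp (-(weightChange cfg.q (difficulty cfg S Θ w) * beta cfg Θ (S i)))

/-- The sample weights `w_k` along the training run on `S` in which `Θ k` are the network
parameters at the beginning of the `k`-th epoch, `k = 1, 2, …`. -/
def weights (cfg : Config Param Sample) (S : Fin N → Sample) (Θ : ℕ → Param) : ℕ → Fin N → ℝ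
  | 0 => fun _ => 1 / (N : ℝ)
  | k + 1 => updateWeights cfg S (Θ (k + 1)) (weights cfg S Θ k)

/-- The training difficulty `ρ_k` at the `k`-th epoch, `1 ≤ k`. -/
def rho (cfg : Config Param Sample) (S : Fin N → Sample) (Θ : ℕ → Param) (k : ℕ) : ℝ :=
  difficulty cfg S (Θ k) (weights cfg S Θ (k - 1))

/-- The weight-change value `α_k` at the `k`-th epoch, `1 ≤ k`. -/
def alpha (cfg : Config Param Sample) (S : Fin N → Sample) (Θ : ℕ → Param) (k : ℕ) : ℝ :=
  weightChange cfg.q (rho cfg S Θ k)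

/-- `A_K = α_1 + ⋯ + α_K`. -/
def cumAlpha (cfg : Config Param Sample) (S : Fin N → Sample) (Θ : ℕ → Param) (K : ℕ) : ℝ :=
  ∑ k ∈ Finset.Icc 1 K, alpha cfg S Θ k

/-- The cumulative training performance `g_K(z) = α_1 β_1(z) + ⋯ + α_K β_K(z)`. -/
def cumPerf (cfg : Config Param Sample) (S : Fin N → Sample) (Θ : ℕ → Param) (K : ℕ)
    (z : Sample) : ℝ :=
  ∑ k ∈ Finset.Icc 1 K, alpha cfg S Θ k * beta cfg (Θ k) z

/-- The epochs `K + 1, …, K + Δ` of the run form a `Δ`-convergence phase. -/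
def IsConvergencePhase (cfg : Config Param Sample) (S : Fin N → Sample) (Θ : ℕ → Param)
    (K Δ : ℕ) : Prop :=
  ∀ k ∈ Finset.Icc (K + 1) (K + Δ), rho cfg S Θ k < 1 / 2

/-- The normalized partial margin `(g_{K+Δ}(z) - g_K(z)) / (A_{K+Δ} - A_K)`. -/
def partialMargin (cfg : Config Param Sample) (S : Fin N → Sample) (Θ : ℕ → Param) (K Δ : ℕ)
    (z : Sample) : ℝ :=
  (cumPerf cfg S Θ (K + Δ) z - cumPerf cfg S Θ K z) /
    (cumAlpha cfg S Θ (K + Δ) - cumAlpha cfg S Θ K)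

/-- The class of the normalized partial margins of all runs on training sets of size `N`, with
network parameters in `W`, that are in a `Δ`-convergence phase after the `K`-th epoch. It does
not depend on any particular training set. -/
def marginClass (cfg : Config Param Sample) (W : Set Param) (N K Δ : ℕ) : Set (Sample → ℝ) :=
  {b | ∃ (S : Fin N → Sample) (Θ : ℕ → Param),
    (∀ k, Θ k ∈ W) ∧
    (∀ k ∈ Finset.Icc 1 (K + Δ), 0 < rho cfg S Θ k ∧ rho cfg S Θ k < 1) ∧
    IsConvergencePhase cfg S Θ K Δ ∧
    b = partialMargin cfg S Θ K Δ}

end APW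

open Classical in
/-- The proportion of the points of the finite sample `S` (counted with repetitions) that lie
in `A`. -/
def empProb {Sample : Type*} {m : ℕ} (S : Fin m → Sample) (A : Set Sample) : ℝ :=
  ((Finset.univ.filter fun i => S i ∈ A).card : ℝ) / (m : ℝ)

/-- `G` is an `ε`-sloppy `θ`-cover of `F` with respect to the sample `S`. -/
def IsSloppyCover {Sample : Type*} {m : ℕ} (F G : Set (Sample → ℝ)) (θ ε : ℝ)
    (S : Fin m → Sample) : Prop :=
  ∀ f ∈ F, ∃ g ∈ G, empProb S {x | θ < |g x - f x|} < ε

/-- The sloppy covering number: the maximum, over all samples `S` of size `m`, of the size of the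
smallest `ε`-sloppy `θ`-cover of `F` with respect to `S`. -/
def sloppyCoveringNumber {Sample : Type*} (F : Set (Sample → ℝ)) (θ ε : ℝ) (m : ℕ) : ℕ∞ :=
  ⨆ S : Fin m → Sample, ⨅ G : Set (Sample → ℝ), ⨅ _ : IsSloppyCover F G θ ε S, G.encard

end

/-! The bound holds for every class of functions parametrized in a jointly measurable way by a
measurable subset of a standard Borel space, and the partial margins are such a class, with the runs
as parameters. It is the Vapnik–Chervonenkis double-sample argument. If the true error of some
member exceeds its empirical margin error by more than `ε`, Chebyshev makes an independent ghost
sample show a gap of at least `ε / 2` with probability at least `1 / 2`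
(`half_le_measure_pi_sub_le_empProb`), so the bad event has at most twice the probability of a gap
between two samples. That probability is unchanged by random swaps of paired points. For a fixed
double sample a sloppy cover reduces the class to finitely many functions, and Hoeffding with a
union bound counts the bad swaps (`card_swapPairs_le_of_isSloppyCover`). The gap event ranges over a
possibly uncountable class. It is a projection of a Borel set, hence analytic and null measurable,
which is what integrating over swaps requires. -/

/-! ### Analytic sets are null measurable. -/

/-- Continuity from below holds for arbitrary increasing sets, so images of unknown measurability
are allowed. -/
theorem exists_measure_image_le_add {α : Type*} [MeasurableSpace α] (μ : Measure α)
    [IsFiniteMeasure μ] (f : (ℕ → ℕ) → α) (s : Set (ℕ → ℕ)) (i : ℕ) {η : ℝ≥0∞} (hη : η ≠ 0) :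
    ∃ m : ℕ, μ (f '' s) ≤ μ (f '' (s ∩ {x | x i ≤ m})) + η := by
  have hmono : Monotone fun m : ℕ => f '' (s ∩ {x | x i ≤ m}) := fun a b hab =>
    Set.image_mono (Set.inter_subset_inter_right _ fun x hx => le_trans hx hab)
  have hU : ⋃ m : ℕ, f '' (s ∩ {x | x i ≤ m}) = f '' s := by
    rw [← Set.image_iUnion, ← Set.inter_iUnion]
    congr 1
    refine Set.inter_eq_left.2 fun x _ => Set.mem_iUnion.2 ⟨x i, le_refl (x i)⟩
  have h := hmono.measure_iUnion (μ := μ)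
  rw [hU] at h
  by_cases h0 : μ (f '' s) = 0
  · exact ⟨0, by simp [h0]⟩
  have hlt : μ (f '' s) - η < μ (f '' s) :=
    ENNReal.sub_lt_self (measure_ne_top _ _) h0 hη
  conv_rhs at hlt => rw [h]
  obtain ⟨m, hm⟩ := lt_iSup_iff.1 hlt
  exact ⟨m, tsub_le_iff_right.1 hm.le⟩

theorem isCompact_setOf_forall_le (n : ℕ → ℕ) : IsCompact {x : ℕ → ℕ | ∀ i, x i ≤ n i} := by
  have : {x : ℕ → ℕ | ∀ i, x i ≤ n i} = Set.pi Set.univ fun i => Set.Iic (n i) := by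
    ext x; simp [Pi.le_def]
  rw [this]
  exact isCompact_univ_pi fun i => (Set.finite_Iic (n i)).isCompact

/-- Finitely many cylinders inside `U` cover the compact box, so one length `k` serves all its
points. -/
theorem exists_forall_lt_le_of_box_subset_isOpen {U : Set (ℕ → ℕ)} (hU : IsOpen U)
    (n : ℕ → ℕ) (h : {x : ℕ → ℕ | ∀ i, x i ≤ n i} ⊆ U) :
    ∃ k, {x : ℕ → ℕ | ∀ i < k, x i ≤ n i} ⊆ U := by
  have hK := isCompact_setOf_forall_le n
  have key : ∃ k, ∀ a ∈ {x : ℕ → ℕ | ∀ i, x i ≤ n i}, ∀ x : ℕ → ℕ,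
      (∀ i < k, x i = a i) → x ∈ U := by
    refine hK.induction_on (p := fun s => ∃ k, ∀ a ∈ s, ∀ x : ℕ → ℕ,
      (∀ i < k, x i = a i) → x ∈ U) ⟨0, by simp⟩ ?_ ?_ ?_
    · rintro s t hst ⟨k, hk⟩
      exact ⟨k, fun a ha => hk a (hst ha)⟩
    · rintro s t ⟨k, hk⟩ ⟨l, hl⟩
      refine ⟨max k l, fun a ha x hx => ha.elim (fun ha => hk a ha x fun i hi => hx i ?_)
        fun ha => hl a ha x fun i hi => hx i ?_⟩
      · exact lt_of_lt_of_le hi (le_max_left _ _)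
      · exact lt_of_lt_of_le hi (le_max_right _ _)
    · intro a ha
      obtain ⟨v, ⟨b, k, rfl⟩, hav, hvU⟩ :=
        (PiNat.isTopologicalBasis_cylinders fun _ => ℕ).exists_subset_of_mem_open (h ha) hU
      refine ⟨PiNat.cylinder b k, mem_nhdsWithin_of_mem_nhds
        ((PiNat.isOpen_cylinder _ b k).mem_nhds hav), k, fun c hc x hx => hvU ?_⟩
      exact fun i hi => (hx i hi).trans (hc i hi)
  obtain ⟨k, hk⟩ := key
  -- Truncating `x` by `n` gives a point of the box that agrees with `x` below `k`.
  exact ⟨k, fun x hx => hk (fun i => min (x i) (n i)) (fun i => min_le_right _ _) x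
    fun i hi => (min_eq_left (hx i hi)).symm⟩

theorem iInter_closure_image_box_subset {α : Type*} [TopologicalSpace α] [T2Space α]
    {f : (ℕ → ℕ) → α} (hf : Continuous f) (n : ℕ → ℕ) :
    ⋂ k, closure (f '' {x | ∀ i < k, x i ≤ n i}) ⊆ f '' {x | ∀ i, x i ≤ n i} := by
  intro y hy
  by_contra hyK
  have hK := (isCompact_setOf_forall_le n).image hf
  obtain ⟨V, U, hV, hU, hKV, hyU, hd⟩ := hK.separation_of_notMem hyK
  obtain ⟨k, hk⟩ := exists_forall_lt_le_of_box_subset_isOpen (hV.preimage hf) n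
    (Set.image_subset_iff.1 hKV)
  have := mem_closure_iff.1 (Set.mem_iInter.1 hy k) U hU hyU
  obtain ⟨z, hzU, hz⟩ := this
  exact Set.disjoint_left.1 hd (Set.image_subset_iff.2 hk hz) hzU

theorem exists_box_measure_range_le_add {α : Type*} [TopologicalSpace α] [T2Space α]
    [MeasurableSpace α] [OpensMeasurableSpace α] (μ : Measure α) [IsFiniteMeasure μ]
    {f : (ℕ → ℕ) → α} (hf : Continuous f) {ε : ℝ≥0∞} (hε : ε ≠ 0) :
    ∃ n : ℕ → ℕ, μ (Set.range f) ≤ μ (f '' {x | ∀ i, x i ≤ n i}) + ε := by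
  obtain ⟨η, hη, hsum⟩ := ENNReal.exists_pos_sum_of_countable' hε ℕ
  choose m hm using fun (s : Set (ℕ → ℕ)) (i : ℕ) =>
    exists_measure_image_le_add μ f s i (hη i).ne'
  -- Coordinates are bounded one at a time; bounding the `k`-th costs at most `η k`, and the costs
  -- sum to less than `ε`.
  let S : ℕ → Set (ℕ → ℕ) := fun k =>
    Nat.rec Set.univ (fun k s => s ∩ {x | x k ≤ m s k}) k
  have hS : ∀ k, S k = {x | ∀ i < k, x i ≤ m (S i) i} := by
    intro k
    induction k with
    | zero => simp [S]
    | succ k ih =>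
      have : S (k + 1) = S k ∩ {x | x k ≤ m (S k) k} := rfl
      rw [this]
      conv_lhs => arg 1; rw [ih]
      ext x
      simp only [Set.mem_inter_iff, Set.mem_ofPred_eq, Nat.forall_lt_succ_right]
  have hμ : ∀ k, μ (Set.range f) ≤ μ (f '' S k) + ∑ i ∈ Finset.range k, η i := by
    intro k
    induction k with
    | zero => simp [S]
    | succ k ih =>
      rw [Finset.sum_range_succ]
      calc μ (Set.range f) ≤ μ (f '' S k) + ∑ i ∈ Finset.range k, η i := ih
        _ ≤ (μ (f '' S (k + 1)) + η k) + ∑ i ∈ Finset.range k, η i := by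
          gcongr; exact hm (S k) k
        _ = _ := by ring
  refine ⟨fun i => m (S i) i, ?_⟩
  -- The images need not be measurable, but their closures are, so continuity from above applies to
  -- these.
  have hanti : Antitone fun k => closure (f '' S k) := by
    refine antitone_nat_of_succ_le fun k => closure_mono (Set.image_mono ?_)
    exact Set.inter_subset_left
  have hsub : ⋂ k, closure (f '' S k) ⊆ f '' {x | ∀ i, x i ≤ m (S i) i} := by
    refine subset_trans (le_of_eq ?_) (iInter_closure_image_box_subset hf fun i => m (S i) i)
    exact Set.iInter_congr fun k => by rw [← hS k]
  calc μ (Set.range f) ≤ (⨅ k, μ (closure (f '' S k))) + ε := by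
        rw [ENNReal.iInf_add]
        refine le_iInf fun k => (hμ k).trans ?_
        exact add_le_add (measure_mono subset_closure) ((ENNReal.sum_le_tsum _).trans hsum.le)
    _ = μ (⋂ k, closure (f '' S k)) + ε := by
        rw [hanti.measure_iInter (fun k => isClosed_closure.nullMeasurableSet)
          ⟨0, measure_ne_top _ _⟩]
    _ ≤ _ := by gcongr

/-- Analytic sets are measurable up to null sets for every finite Borel measure. -/
theorem MeasureTheory.AnalyticSet.nullMeasurableSet_of_isFiniteMeasure {α : Type*}
    [TopologicalSpace α] [T2Space α] [MeasurableSpace α] [OpensMeasurableSpace α] {s : Set α}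
    (hs : AnalyticSet s) (μ : Measure α) [IsFiniteMeasure μ] : NullMeasurableSet s μ := by
  rw [AnalyticSet] at hs
  rcases hs with rfl | ⟨f, hf, rfl⟩
  · exact nullMeasurableSet_empty
  have hpos : ∀ j : ℕ, ((j : ℝ≥0∞) + 1)⁻¹ ≠ 0 := fun j => by simp
  choose n hn using fun j : ℕ => exists_box_measure_range_le_add μ hf (hpos j)
  have hK : ∀ j, MeasurableSet (f '' {x | ∀ i, x i ≤ n j i}) := fun j =>
    ((isCompact_setOf_forall_le (n j)).image hf).isClosed.measurableSet
  have hB : MeasurableSet (⋃ j, f '' {x | ∀ i, x i ≤ n j i}) := MeasurableSet.iUnion hK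
  have hsub : (⋃ j, f '' {x | ∀ i, x i ≤ n j i}) ⊆ Set.range f :=
    Set.iUnion_subset fun j => Set.image_subset_range _ _
  refine hB.nullMeasurableSet.congr
    (ae_eq_of_subset_of_measure_ge hsub ?_ hB.nullMeasurableSet (measure_ne_top _ _))
  refine ENNReal.le_of_forall_pos_le_add fun ε hε _ => ?_
  obtain ⟨j, hj⟩ := ENNReal.exists_inv_nat_lt (a := (ε : ℝ≥0∞)) (by simpa using hε.ne')
  refine (hn j).trans (add_le_add 
    (measure_mono (Set.subset_iUnion (fun j => f '' {x | ∀ i, x i ≤ n j i}) j))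
    (le_trans ?_ hj.le))
  exact ENNReal.inv_le_inv.2 le_self_add

theorem MeasurableSet.nullMeasurableSet_image {X Y : Type*} [MeasurableSpace X]
    [StandardBorelSpace X] [MeasurableSpace Y] [StandardBorelSpace Y] {s : Set X}
    (hs : MeasurableSet s) {f : X → Y} (hf : Measurable f) (μ : Measure Y) [IsFiniteMeasure μ] :
    NullMeasurableSet (f '' s) μ := by
  let _ := upgradeStandardBorel Y
  exact (hs.analyticSet_image hf).nullMeasurableSet_of_isFiniteMeasure μ

/-! ### Random signs and swaps of pairs. -/

open Classical in
/-- **Hoeffding's inequality** for random signs, as a count of sign patterns. -/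
theorem card_signs_lt_sum_le {N : ℕ} (hN : 0 < N) (a : Fin N → ℝ) (ha : ∀ i, |a i| ≤ 1)
    {t : ℝ} (ht : 0 ≤ t) :
    ((Finset.univ.filter fun σ : Fin N → Bool => t < ∑ i, if σ i then a i else -a i).card : ℝ) ≤
      2 ^ N * Real.exp (-(t ^ 2 / (2 * N))) := by
  have hN' : (0 : ℝ) < N := by exact_mod_cast hN
  -- This `l` minimizes the Chernoff exponent `N * l ^ 2 / 2 - l * t`.
  set l : ℝ := t / N with hl
  have hl0 : 0 ≤ l := by positivity
  have h1 : ((Finset.univ.filter fun σ : Fin N → Bool =>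
      t < ∑ i, if σ i then a i else -a i).card : ℝ) * Real.exp (l * t) ≤
      ∑ σ : Fin N → Bool, Real.exp (l * ∑ i, if σ i then a i else -a i) := by
    rw [← nsmul_eq_mul, ← Finset.sum_const]
    refine (Finset.sum_le_sum fun σ hσ => ?_).trans
      (Finset.sum_le_sum_of_subset_of_nonneg (Finset.filter_subset _ _)
        fun _ _ _ => (Real.exp_pos _).le)
    have := (Finset.mem_filter.1 hσ).2
    gcongr
  have h2 : ∑ σ : Fin N → Bool, Real.exp (l * ∑ i, if σ i then a i else -a i) =
      ∏ i, (2 * Real.cosh (l * a i)) := by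
    have := Finset.sum_prod_piFinset (Finset.univ : Finset Bool)
      (fun (i : Fin N) (s : Bool) => Real.exp (l * if s then a i else -a i))
    rw [Fintype.piFinset_univ] at this
    simp_rw [Finset.mul_sum, Real.exp_sum, this, Real.cosh_eq]
    refine Finset.prod_congr rfl fun i _ => ?_
    simp
    ring
  have h3 : ∏ i, (2 * Real.cosh (l * a i)) ≤ 2 ^ N * Real.exp (N * (l ^ 2 / 2)) := by
    calc ∏ i, (2 * Real.cosh (l * a i)) ≤ ∏ _i : Fin N, (2 * Real.exp (l ^ 2 / 2)) := by
          refine Finset.prod_le_prod (fun i _ => by positivity) fun i _ => ?_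
          refine mul_le_mul_of_nonneg_left ((Real.cosh_le_exp_half_sq _).trans ?_) zero_le_two
          have : (l * a i) ^ 2 ≤ l ^ 2 := by
            rw [mul_pow]
            exact mul_le_of_le_one_right (sq_nonneg _) ((sq_le_one_iff_abs_le_one _).2 (ha i))
          gcongr
      _ = _ := by
          rw [Finset.prod_const, mul_pow, ← Real.exp_nat_mul]; simp
  have h4 := (h1.trans_eq h2).trans h3
  have h5 : Real.exp (N * (l ^ 2 / 2)) = Real.exp (-(t ^ 2 / (2 * N))) * Real.exp (l * t) := by
    rw [← Real.exp_add, hl]; congr 1; field_simp; ring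
  rw [h5, ← mul_assoc] at h4
  exact le_of_mul_le_mul_right h4 (Real.exp_pos _)

/-- Exchange the two components of the pairs `x i` for which `σ i` is false. -/
def swapPairs {X : Type*} {N : ℕ} (σ : Fin N → Bool) (x : Fin N → X × X) : Fin N → X × X :=
  fun i => if σ i then x i else (x i).swap

theorem measurePreserving_swapPairs {X : Type*} [MeasurableSpace X] {N : ℕ} (μ : Measure X)
    [SigmaFinite μ] (σ : Fin N → Bool) :
    MeasurePreserving (swapPairs σ) (Measure.pi fun _ : Fin N => μ.prod μ)
      (Measure.pi fun _ : Fin N => μ.prod μ) := by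
  refine measurePreserving_pi (fun _ => μ.prod μ) (fun _ => μ.prod μ)
    (f := fun i (p : X × X) => if σ i then p else p.swap) fun i => ?_
  cases σ i
  · simpa using Measure.measurePreserving_swap (μ := μ) (ν := μ)
  · simp only [if_true]
    exact MeasurePreserving.id (μ.prod μ)

open Classical in
-- Each swap preserves the product measure, so the measure of `A` is the integral of the fraction of
-- swaps that land in `A`.
theorem measure_pi_prod_le_of_card_swapPairs_le {X : Type*} [MeasurableSpace X] {N : ℕ}
    (μ : Measure X) [IsProbabilityMeasure μ] {A : Set (Fin N → X × X)}
    (hA : NullMeasurableSet A (Measure.pi fun _ : Fin N => μ.prod μ)) {c : ℝ≥0∞}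
    (h : ∀ x, ((Finset.univ.filter fun σ : Fin N → Bool => swapPairs σ x ∈ A).card : ℝ≥0∞) ≤
      2 ^ N * c) :
    (Measure.pi fun _ : Fin N => μ.prod μ) A ≤ c := by
  set m := Measure.pi fun _ : Fin N => μ.prod μ
  have hσ : ∀ σ : Fin N → Bool, NullMeasurableSet (swapPairs σ ⁻¹' A) m := fun σ =>
    hA.preimage (measurePreserving_swapPairs μ σ).quasiMeasurePreserving
  have key : 2 ^ N * m A ≤ 2 ^ N * c := calc
    2 ^ N * m A = ∑ σ : Fin N → Bool, m (swapPairs σ ⁻¹' A) := by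
      have : ∀ σ : Fin N → Bool, m (swapPairs σ ⁻¹' A) = m A := fun σ =>
        (measurePreserving_swapPairs μ σ).measure_preimage hA
      simp [this]
    _ = ∑ σ : Fin N → Bool, ∫⁻ x, (swapPairs σ ⁻¹' A).indicator 1 x ∂m :=
      Finset.sum_congr rfl fun σ _ => (lintegral_indicator_one₀ (hσ σ)).symm
    _ = ∫⁻ x, ∑ σ : Fin N → Bool, (swapPairs σ ⁻¹' A).indicator 1 x ∂m :=
      (lintegral_finsetSum' _ fun σ _ => (aemeasurable_indicator_const_iff 1).2 (hσ σ)).symm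
    _ ≤ ∫⁻ _, 2 ^ N * c ∂m := by
      refine lintegral_mono fun x => le_trans (le_of_eq ?_) (h x)
      simp [Set.indicator_apply]
    _ = 2 ^ N * c := by simp [m]
  rwa [ENNReal.mul_le_mul_iff_right (by simp) (by simp)] at key

/-! ### Counting bad swaps through a sloppy cover. -/

theorem empProb_eq_sum {X : Type*} {m : ℕ} (S : Fin m → X) (A : Set X) :
    empProb S A = (∑ i, A.indicator (1 : X → ℝ) (S i)) / m := by
  classical
  simp [empProb, Set.indicator_apply]

/-- Where `|g - b| ≤ θ / 2`, `b ≤ 0` forces `g ≤ θ / 2`, which forces `b ≤ θ`; the last two terms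
pay for the other points. -/
theorem indicator_sub_indicator_le {X : Type*} (b g : X → ℝ) (θ : ℝ) (u v : X) :
    {z | b z ≤ 0}.indicator (1 : X → ℝ) v - {z | b z ≤ θ}.indicator (1 : X → ℝ) u ≤
      ({z | g z ≤ θ / 2}.indicator (1 : X → ℝ) v - {z | g z ≤ θ / 2}.indicator (1 : X → ℝ) u) +
      ({z | θ / 2 < |g z - b z|}.indicator (1 : X → ℝ) u +
        {z | θ / 2 < |g z - b z|}.indicator (1 : X → ℝ) v) := by
  have hv : {z | b z ≤ 0}.indicator (1 : X → ℝ) v ≤ {z | g z ≤ θ / 2}.indicator (1 : X → ℝ) v +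
      {z | θ / 2 < |g z - b z|}.indicator (1 : X → ℝ) v := by
    simp only [Set.indicator_apply, Set.mem_ofPred_eq, Pi.one_apply]
    split_ifs with h1 h2 h3 h3 <;> norm_num
    exact h3 (lt_of_lt_of_le (by linarith) (le_abs_self _))
  have hu : {z | g z ≤ θ / 2}.indicator (1 : X → ℝ) u ≤ {z | b z ≤ θ}.indicator (1 : X → ℝ) u +
      {z | θ / 2 < |g z - b z|}.indicator (1 : X → ℝ) u := by
    simp only [Set.indicator_apply, Set.mem_ofPred_eq, Pi.one_apply]
    split_ifs with h1 h2 h3 h3 <;> norm_num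
    exact h3 (lt_of_lt_of_le (by linarith) (neg_le_abs _))
  linarith

/-- The sample of size `2 * N` that consists of the components of `N` pairs. -/
def pairsSample {X : Type*} {N : ℕ} (x : Fin N → X × X) : Fin (2 * N) → X := fun j =>
  Sum.elim (fun i => (x i).1) (fun i => (x i).2) (finSumFinEquiv.symm (finCongr (two_mul N) j))

theorem sum_pairsSample {X : Type*} {N : ℕ} (x : Fin N → X × X) (h : X → ℝ) :
    ∑ j, h (pairsSample x j) = ∑ i, (h (x i).1 + h (x i).2) := by
  unfold pairsSample
  refine (((finCongr (two_mul N)).trans finSumFinEquiv.symm).sum_comp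
    (fun s => h (Sum.elim (fun i => (x i).1) (fun i => (x i).2) s))).trans ?_
  rw [Fintype.sum_sum_type, Finset.sum_add_distrib]
  rfl

open Classical in
-- Fewer than `2 * N * (ε / 8)` points are badly approximated, so a gap of `N * ε / 2` leaves more
-- than `N * ε / 4` for a signed sum of the cover element. Hoeffding at this level gives the
-- exponent `ε ^ 2 * N / 32`.
theorem card_swapPairs_le_of_isSloppyCover {X : Type*} {N : ℕ} (hN : 0 < N)
    {F : Set (X → ℝ)} {θ ε : ℝ} (hε : 0 < ε) (x : Fin N → X × X) (G : Finset (X → ℝ))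
    (hG : IsSloppyCover F (G : Set (X → ℝ)) (θ / 2) (ε / 8) (pairsSample x)) :
    ((Finset.univ.filter fun σ : Fin N → Bool => ∃ b ∈ F,
      empProb (fun i => (swapPairs σ x i).1) {z | b z ≤ θ} + ε / 2 ≤
        empProb (fun i => (swapPairs σ x i).2) {z | b z ≤ 0}).card : ℝ) ≤
      G.card * (2 ^ N * Real.exp (-(ε ^ 2 * N / 32))) := by
  have hN' : (0 : ℝ) < N := by exact_mod_cast hN
  let a : (X → ℝ) → Fin N → ℝ := fun g i =>
    {z | g z ≤ θ / 2}.indicator (1 : X → ℝ) (x i).2 -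
      {z | g z ≤ θ / 2}.indicator (1 : X → ℝ) (x i).1
  have hcount : ∀ g, ((Finset.univ.filter fun σ : Fin N → Bool =>
      ε / 4 * N < ∑ i, if σ i then a g i else -a g i).card : ℝ) ≤
      2 ^ N * Real.exp (-(ε ^ 2 * N / 32)) := by
    intro g
    refine (card_signs_lt_sum_le hN (a g) (fun i => ?_) (by positivity)).trans_eq ?_
    · simp only [a, Set.indicator_apply, Pi.one_apply]
      split_ifs <;> norm_num
    · congr 3; field_simp; ring
  have hsub : (Finset.univ.filter fun σ : Fin N → Bool => ∃ b ∈ F,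
      empProb (fun i => (swapPairs σ x i).1) {z | b z ≤ θ} + ε / 2 ≤
        empProb (fun i => (swapPairs σ x i).2) {z | b z ≤ 0}) ⊆
      G.biUnion fun g => Finset.univ.filter fun σ : Fin N → Bool =>
        ε / 4 * N < ∑ i, if σ i then a g i else -a g i := by
    intro σ hσ
    obtain ⟨b, hb, hbσ⟩ := (Finset.mem_filter.1 hσ).2
    obtain ⟨g, hg, hgb⟩ := hG b hb
    refine Finset.mem_biUnion.2 ⟨g, hg, Finset.mem_filter.2 ⟨Finset.mem_univ _, ?_⟩⟩
    rw [empProb_eq_sum, sum_pairsSample, div_lt_iff₀ (by push_cast; positivity)] at hgb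
    rw [empProb_eq_sum, empProb_eq_sum, div_add' _ _ _ hN'.ne',
      div_le_div_iff_of_pos_right hN'] at hbσ
    have hsum := Finset.sum_le_sum fun i (_ : i ∈ Finset.univ) =>
      indicator_sub_indicator_le b g θ (swapPairs σ x i).1 (swapPairs σ x i).2
    rw [Finset.sum_sub_distrib, Finset.sum_add_distrib] at hsum
    have h1 : ∑ i, ({z | g z ≤ θ / 2}.indicator (1 : X → ℝ) (swapPairs σ x i).2 -
        {z | g z ≤ θ / 2}.indicator (1 : X → ℝ) (swapPairs σ x i).1) =
        ∑ i, if σ i then a g i else -a g i := by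
      refine Finset.sum_congr rfl fun i _ => ?_
      cases h : σ i <;> simp [swapPairs, h, a]
    -- The count of badly approximated points is symmetric in each pair, so swaps do not affect it.
    have h2 : ∑ i, ({z | θ / 2 < |g z - b z|}.indicator (1 : X → ℝ) (swapPairs σ x i).1 +
        {z | θ / 2 < |g z - b z|}.indicator (1 : X → ℝ) (swapPairs σ x i).2) =
        ∑ i, ({z | θ / 2 < |g z - b z|}.indicator (1 : X → ℝ) (x i).1 +
        {z | θ / 2 < |g z - b z|}.indicator (1 : X → ℝ) (x i).2) := by
      refine Finset.sum_congr rfl fun i _ => ?_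
      cases h : σ i <;> simp [swapPairs, h, add_comm]
    rw [h1, h2] at hsum
    push_cast at hgb
    linarith
  calc _ ≤ ((G.biUnion fun g => Finset.univ.filter fun σ : Fin N → Bool =>
        ε / 4 * N < ∑ i, if σ i then a g i else -a g i).card : ℝ) := by
        exact_mod_cast Finset.card_le_card hsub
    _ ≤ ∑ g ∈ G, ((Finset.univ.filter fun σ : Fin N → Bool =>
        ε / 4 * N < ∑ i, if σ i then a g i else -a g i).card : ℝ) := by
        exact_mod_cast Finset.card_biUnion_le
    _ ≤ ∑ _g ∈ G, 2 ^ N * Real.exp (-(ε ^ 2 * N / 32)) := Finset.sum_le_sum fun g _ => hcount g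
    _ = _ := by rw [Finset.sum_const, nsmul_eq_mul]

/-! ### The ghost sample and the general margin bound. -/

/-- An indicator has variance at most `1 / 4`, so Chebyshev bounds the failure probability by `1 /
(N * ε ^ 2) ≤ 1 / 2`. -/
theorem half_le_measure_pi_sub_le_empProb {X : Type*} [MeasurableSpace X] {N : ℕ} (hN : 0 < N)
    (μ : Measure X) [IsProbabilityMeasure μ] {B : Set X} (hB : MeasurableSet B) {ε : ℝ}
    (hε : 0 < ε) (hNε : 2 ≤ N * ε ^ 2) :
    (1 / 2 : ℝ≥0∞) ≤ (Measure.pi fun _ : Fin N => μ) {S | μ.real B - ε / 2 ≤ empProb S B} := by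
  have hN' : (0 : ℝ) < N := by exact_mod_cast hN
  set m := Measure.pi fun _ : Fin N => μ
  have hf : Measurable (B.indicator (1 : X → ℝ)) := measurable_one.indicator hB
  have hbd : ∀ z, B.indicator (1 : X → ℝ) z ∈ Set.Icc (0 : ℝ) 1 := fun z => by
    by_cases h : z ∈ B <;> simp [h]
  have hL : MemLp (B.indicator (1 : X → ℝ)) 2 μ :=
    memLp_of_bounded (ae_of_all _ hbd) hf.aestronglyMeasurable 2
  set Y : (Fin N → X) → ℝ := ∑ i : Fin N, fun S => B.indicator (1 : X → ℝ) (S i) with hY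
  have hY' : Y = fun S => ∑ i, B.indicator (1 : X → ℝ) (S i) := by
    funext S; simp [hY]
  have hYL : MemLp Y 2 m := memLp_finsetSum' _ fun i _ =>
    hL.comp_measurePreserving (measurePreserving_eval (fun _ : Fin N => μ) i)
  have hvar : ProbabilityTheory.variance Y m ≤ N / 4 := by
    have h1 : ProbabilityTheory.variance Y m =
        ∑ _i : Fin N, ProbabilityTheory.variance (B.indicator (1 : X → ℝ)) μ :=
      ProbabilityTheory.variance_sum_pi (X := fun _ : Fin N => B.indicator (1 : X → ℝ))
        fun _ => hL
    have h2 := ProbabilityTheory.variance_le_sq_of_bounded (ae_of_all μ hbd) hf.aemeasurable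
    rw [h1, Finset.sum_const, Finset.card_univ, Fintype.card_fin, nsmul_eq_mul]
    nlinarith
  have hmean : ∫ S, Y S ∂m = N * μ.real B := by
    have h1 : ∀ i : Fin N, ∫ S, B.indicator (1 : X → ℝ) (S i) ∂m = μ.real B := fun i => by
      rw [← integral_indicator_one hB]
      exact integral_comp_eval (μ := fun _ : Fin N => μ) (i := i) hf.aestronglyMeasurable
    simp only [hY']
    rw [integral_finsetSum _ fun i _ => ?_]
    · simp [h1]
    · exact (hL.comp_measurePreserving
        (measurePreserving_eval (fun _ : Fin N => μ) i)).integrable (by norm_num)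
  have hcheb := ProbabilityTheory.meas_ge_le_variance_div_sq hYL
    (c := N * ε / 2) (by positivity)
  have hsmall : m {S | N * ε / 2 ≤ |Y S - ∫ S, Y S ∂m|} ≤ 1 / 2 := by
    refine hcheb.trans ?_
    rw [← ENNReal.ofReal_one, ← ENNReal.ofReal_ofNat 2, ← ENNReal.ofReal_div_of_pos (by norm_num)]
    refine ENNReal.ofReal_le_ofReal ?_
    rw [div_le_iff₀ (by positivity)]
    nlinarith
  have hYm : Measurable Y := by
    rw [hY']
    exact Finset.measurable_sum _ fun i _ => hf.comp (measurable_pi_apply i)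
  have hms : MeasurableSet {S | N * ε / 2 ≤ |Y S - ∫ S, Y S ∂m|} :=
    measurableSet_le measurable_const (by fun_prop)
  have hcompl : {S | N * ε / 2 ≤ |Y S - ∫ S, Y S ∂m|}ᶜ ⊆
      {S | μ.real B - ε / 2 ≤ empProb S B} := by
    intro S hS
    rw [Set.mem_compl_iff, Set.mem_ofPred_eq, not_le] at hS
    have hS' := (abs_lt.1 hS).1
    rw [hmean] at hS'
    rw [Set.mem_ofPred_eq, empProb_eq_sum, ← congrFun hY' S, le_div_iff₀ hN']
    linarith
  refine le_trans ?_ (measure_mono hcompl)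
  rw [prob_compl_eq_one_sub hms]
  refine le_trans (le_of_eq ?_) (tsub_le_tsub_left hsmall 1)
  simp

theorem measurable_empProb {P X Y : Type*} [MeasurableSpace P] [MeasurableSpace X]
    [MeasurableSpace Y] {N : ℕ} {b : P → X → ℝ} (hb : Measurable (Function.uncurry b)) (t : ℝ)
    {S : Y → Fin N → X} (hS : Measurable S) {p : Y → P} (hp : Measurable p) :
    Measurable fun y => empProb (S y) {z | b (p y) z ≤ t} := by
  simp only [empProb_eq_sum]
  refine Measurable.div_const (Finset.measurable_fun_sum _ fun i _ => ?_) _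
  have hset : MeasurableSet {y | b (p y) (S y i) ≤ t} :=
    measurableSet_le (hb.comp (hp.prodMk (measurable_pi_iff.1 hS i))) measurable_const
  exact (measurable_one (α := ℝ)).indicator hset

theorem exists_isSloppyCover_of_sloppyCoveringNumber_le {X : Type*} {F : Set (X → ℝ)} {θ ε : ℝ}
    {m n : ℕ} (h : sloppyCoveringNumber F θ ε m ≤ n) (S : Fin m → X) :
    ∃ G : Finset (X → ℝ), IsSloppyCover F (G : Set (X → ℝ)) θ ε S ∧ G.card ≤ n := by
  -- The strict bound by `n + 1` yields an actual cover from the infimum.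
  have h1 : (⨅ G : Set (X → ℝ), ⨅ _ : IsSloppyCover F G θ ε S, G.encard) < (n + 1 : ℕ) :=
    lt_of_le_of_lt ((le_iSup (fun S : Fin m → X =>
      ⨅ G : Set (X → ℝ), ⨅ _ : IsSloppyCover F G θ ε S, G.encard) S).trans h)
      (by exact_mod_cast Nat.lt_succ_self n)
  obtain ⟨G, hG⟩ := iInf_lt_iff.1 h1
  obtain ⟨hGc, hG⟩ := iInf_lt_iff.1 hG
  have hfin : G.Finite := Set.encard_lt_top_iff.1 (hG.trans (ENat.natCast_lt_top _))
  refine ⟨hfin.toFinset, by simpa using hGc, ?_⟩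
  rw [hfin.encard_eq_coe_toFinset_card] at hG
  exact Nat.lt_succ_iff.1 (by exact_mod_cast hG)

theorem one_le_sloppyCoveringNumber {X : Type*} [Nonempty X] {F : Set (X → ℝ)} (hF : F.Nonempty)
    (θ ε : ℝ) (m : ℕ) : 1 ≤ sloppyCoveringNumber F θ ε m := by
  obtain ⟨f, hf⟩ := hF
  refine le_iSup_of_le (fun _ => Classical.arbitrary X) (le_iInf₂ fun G hG => ?_)
  obtain ⟨g, hg, -⟩ := hG f hf
  exact Set.one_le_encard_iff_nonempty.2 ⟨g, hg⟩

/-- The measure of the double samples on which some member of a measurably parametrized class has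
empirical margin errors that differ by `ε / 2`. -/
theorem measure_ghost_deviation_le {P X : Type*} [MeasurableSpace P] [StandardBorelSpace P]
    [MeasurableSpace X] [StandardBorelSpace X] {b : P → X → ℝ}
    (hb : Measurable (Function.uncurry b)) {M : Set P} (hM : MeasurableSet M)
    (μ : Measure X) [IsProbabilityMeasure μ] {N n : ℕ} (hN : 0 < N) {ε θ : ℝ} (hε : 0 < ε)
    (hn : sloppyCoveringNumber (b '' M) (θ / 2) (ε / 8) (2 * N) ≤ n) :
    NullMeasurableSet {x : (Fin N → X) × (Fin N → X) | ∃ f ∈ b '' M,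
        empProb x.1 {z | f z ≤ θ} + ε / 2 ≤ empProb x.2 {z | f z ≤ 0}}
      ((Measure.pi fun _ : Fin N => μ).prod (Measure.pi fun _ : Fin N => μ)) ∧
    ((Measure.pi fun _ : Fin N => μ).prod (Measure.pi fun _ : Fin N => μ))
      {x : (Fin N → X) × (Fin N → X) | ∃ f ∈ b '' M,
        empProb x.1 {z | f z ≤ θ} + ε / 2 ≤ empProb x.2 {z | f z ≤ 0}} ≤
      n * ENNReal.ofReal (Real.exp (-(ε ^ 2 * N / 32))) := by
  set A := {x : (Fin N → X) × (Fin N → X) | ∃ f ∈ b '' M,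
        empProb x.1 {z | f z ≤ θ} + ε / 2 ≤ empProb x.2 {z | f z ≤ 0}} with hA
  set m := (Measure.pi fun _ : Fin N => μ).prod (Measure.pi fun _ : Fin N => μ)
  have hAm : NullMeasurableSet A m := by
    -- `A` is the projection of this measurable set along the parameter.
    have hT : MeasurableSet {y : P × ((Fin N → X) × (Fin N → X)) | y.1 ∈ M ∧
        empProb y.2.1 {z | b y.1 z ≤ θ} + ε / 2 ≤ empProb y.2.2 {z | b y.1 z ≤ 0}} :=
      (measurable_fst hM).inter (measurableSet_le
        ((measurable_empProb hb θ measurable_snd.fst measurable_fst).add_const _)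
        (measurable_empProb hb 0 measurable_snd.snd measurable_fst))
    convert hT.nullMeasurableSet_image measurable_snd m using 1
    ext x
    simp [hA]
  refine ⟨hAm, ?_⟩
  have he := measurePreserving_arrowProdEquivProdArrow X X (Fin N) (fun _ => μ) (fun _ => μ)
  rw [← he.measure_preimage hAm]
  refine measure_pi_prod_le_of_card_swapPairs_le μ
    (hAm.preimage he.quasiMeasurePreserving) fun x => ?_
  obtain ⟨G, hG, hGn⟩ := exists_isSloppyCover_of_sloppyCoveringNumber_le hn (pairsSample x)
  have hcard := card_swapPairs_le_of_isSloppyCover hN hε x G hG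
  have hn' : (G.card : ℝ) ≤ n := by exact_mod_cast hGn
  have h1 := hcard.trans (mul_le_mul_of_nonneg_right hn' (by positivity))
  have h2 := ENNReal.ofReal_le_ofReal h1
  rw [ENNReal.ofReal_natCast, ENNReal.ofReal_mul (by positivity), ENNReal.ofReal_mul
    (by positivity), ENNReal.ofReal_natCast, ENNReal.ofReal_pow (by norm_num),
    ENNReal.ofReal_ofNat] at h2
  rw [mul_left_comm]
  exact h2

/-- Margin bound for a measurably parametrized class of functions, by its sloppy covering number. -/
theorem exists_measurableSet_margin_bound {P X : Type*} [MeasurableSpace P]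
    [StandardBorelSpace P] [MeasurableSpace X] [StandardBorelSpace X] {b : P → X → ℝ}
    (hb : Measurable (Function.uncurry b)) {M : Set P} (hM : MeasurableSet M)
    (μ : Measure X) [IsProbabilityMeasure μ] {N : ℕ} (hN : 0 < N) {ε θ : ℝ} (hε : 0 < ε) :
    ∃ E : Set (Fin N → X), MeasurableSet E ∧
      1 - 2 * ((sloppyCoveringNumber (b '' M) (θ / 2) (ε / 8) (2 * N) : ℕ∞) : ℝ≥0∞) *
          ENNReal.ofReal (Real.exp (-(ε ^ 2 * N / 32))) ≤ (Measure.pi fun _ : Fin N => μ) E ∧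
      ∀ S ∈ E, ∀ f ∈ b '' M, μ.real {z | f z ≤ 0} ≤ empProb S {z | f z ≤ θ} + ε := by
  rcases (b '' M).eq_empty_or_nonempty with hF | hF
  · exact ⟨Set.univ, MeasurableSet.univ, by simp, by simp [hF]⟩
  have hX : Nonempty X := μ.nonempty_of_neZero
  have hexp : ENNReal.ofReal (Real.exp (-(ε ^ 2 * N / 32))) ≠ 0 := by
    simpa using Real.exp_pos _
  rcases eq_or_ne (sloppyCoveringNumber (b '' M) (θ / 2) (ε / 8) (2 * N)) ⊤ with htop | htop
  · exact ⟨∅, MeasurableSet.empty, by simp [htop, ENNReal.top_mul hexp], by simp⟩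
  obtain ⟨n, hn⟩ := ENat.ne_top_iff_exists.1 htop
  rcases lt_or_ge (N * ε ^ 2) 2 with hNε | hNε
  -- Too few samples for Chebyshev, but the claim is vacuous: the exponential is at least `15 / 16`
  -- and the covering number at least `1`.
  · refine ⟨∅, MeasurableSet.empty, ?_, by simp⟩
    have h1 := one_le_sloppyCoveringNumber hF (θ / 2) (ε / 8) (2 * N)
    have h2 : (1 : ℝ≥0∞) ≤ 2 * ENNReal.ofReal (Real.exp (-(ε ^ 2 * N / 32))) := by
      rw [← ENNReal.ofReal_ofNat 2, ← ENNReal.ofReal_mul (by norm_num), ENNReal.one_le_ofReal]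
      have := Real.add_one_le_exp (-(ε ^ 2 * N / 32))
      linarith
    have h3 : (1 : ℝ≥0∞) ≤
        ((sloppyCoveringNumber (b '' M) (θ / 2) (ε / 8) (2 * N) : ℕ∞) : ℝ≥0∞) := by
      exact_mod_cast h1
    rw [measure_empty, nonpos_iff_eq_zero, tsub_eq_zero_iff_le]
    calc (1 : ℝ≥0∞) ≤ 1 * (2 * ENNReal.ofReal (Real.exp (-(ε ^ 2 * N / 32)))) := by simpa using h2
      _ ≤ _ := by rw [mul_comm 2, mul_comm 2, mul_right_comm, mul_assoc]; gcongr
  obtain ⟨hAm, hAle⟩ := measure_ghost_deviation_le hb hM μ hN hε hn.symm.le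
  set A := {x : (Fin N → X) × (Fin N → X) | ∃ f ∈ b '' M,
        empProb x.1 {z | f z ≤ θ} + ε / 2 ≤ empProb x.2 {z | f z ≤ 0}} with hA
  set m := Measure.pi fun _ : Fin N => μ
  -- A measurable hull of the same measure, whose sections have measurable measure.
  set T := toMeasurable (m.prod m) A
  have hT : MeasurableSet T := measurableSet_toMeasurable _ _
  have hsec : Measurable fun S => m (Prod.mk S ⁻¹' T) := measurable_measure_prodMk_left hT
  have hbad : MeasurableSet {S | (1 / 2 : ℝ≥0∞) ≤ m (Prod.mk S ⁻¹' T)} :=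
    measurableSet_le measurable_const hsec
  refine ⟨{S | (1 / 2 : ℝ≥0∞) ≤ m (Prod.mk S ⁻¹' T)}ᶜ, hbad.compl, ?_, ?_⟩
  · rw [prob_compl_eq_one_sub hbad]
    refine tsub_le_tsub_left ?_ 1
    -- Markov's inequality at level `1 / 2` produces the factor `2`.
    refine (meas_ge_le_lintegral_div hsec.aemeasurable (by simp) (by simp)).trans ?_
    rw [← Measure.prod_apply hT, measure_toMeasurable, ← hn, ENNReal.div_eq_inv_mul,
      one_div, inv_inv, mul_assoc]
    gcongr
    simpa using hAle
  · rintro S hS f hf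
    by_contra! hlt
    obtain ⟨p, hp, rfl⟩ := hf
    have hB : MeasurableSet {z | b p z ≤ 0} :=
      measurableSet_le (hb.comp measurable_prodMk_left) measurable_const
    refine hS ((half_le_measure_pi_sub_le_empProb hN μ hB hε hNε).trans (measure_mono ?_))
    intro S' hS'
    refine subset_toMeasurable _ _ ⟨b p, ⟨p, hp, rfl⟩, ?_⟩
    have : μ.real {z | b p z ≤ 0} - ε / 2 ≤ empProb S' {z | b p z ≤ 0} := hS'
    show empProb S _ + ε / 2 ≤ empProb S' _
    linarith

/-! ### Measurability of the training runs. -/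

namespace APW

variable {Param Sample : Type*}

/-- The runs (a training set and a sequence of parameters) that define `marginClass`. -/
def admissibleRuns (cfg : Config Param Sample) (W : Set Param) (N K Δ : ℕ) :
    Set ((Fin N → Sample) × (ℕ → Param)) :=
  {p | (∀ k, p.2 k ∈ W) ∧
    (∀ k ∈ Finset.Icc 1 (K + Δ), 0 < rho cfg p.1 p.2 k ∧ rho cfg p.1 p.2 k < 1) ∧
    IsConvergencePhase cfg p.1 p.2 K Δ}

theorem marginClass_eq_image (cfg : Config Param Sample) (W : Set Param) (N K Δ : ℕ) :
    marginClass cfg W N K Δ =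
      (fun p => partialMargin cfg p.1 p.2 K Δ) '' admissibleRuns cfg W N K Δ := by
  ext b
  simp only [marginClass, admissibleRuns, Set.mem_ofPred_eq, Set.mem_image, Prod.exists]
  exact ⟨fun ⟨S, Θ, h1, h2, h3, h4⟩ => ⟨S, Θ, ⟨h1, h2, h3⟩, h4.symm⟩,
    fun ⟨S, Θ, ⟨h1, h2, h3⟩, h4⟩ => ⟨S, Θ, h1, h2, h3, h4.symm⟩⟩

variable {N : ℕ} [MeasurableSpace Param] [MeasurableSpace Sample] {cfg : Config Param Sample}

theorem measurable_beta (hloss : Measurable (Function.uncurry cfg.loss)) {Y : Type*}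
    [MeasurableSpace Y] {Θ : Y → Param} {z : Y → Sample} (hΘ : Measurable Θ)
    (hz : Measurable z) : Measurable fun y => beta cfg (Θ y) (z y) :=
  Measurable.ite (measurableSet_le (hloss.comp (hΘ.prodMk hz)) measurable_const)
    measurable_const measurable_const

theorem measurable_difficulty (hloss : Measurable (Function.uncurry cfg.loss)) {Y : Type*}
    [MeasurableSpace Y] {S : Y → Fin N → Sample} {Θ : Y → Param} {w : Y → Fin N → ℝ}
    (hS : Measurable S) (hΘ : Measurable Θ) (hw : Measurable w) :
    Measurable fun y => difficulty cfg (S y) (Θ y) (w y) := by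
  -- The set of hard indices varies with `y`; the rewritten sum has a fixed index set.
  simp only [difficulty, Finset.sum_filter]
  refine measurable_const.max (measurable_const.min (Finset.measurable_sum _ fun n _ => ?_))
  exact Measurable.ite (measurable_beta hloss hΘ (measurable_pi_iff.1 hS n)
    (measurableSet_singleton (-1))) (measurable_pi_iff.1 hw n) measurable_const

theorem measurable_weightChange (q : ℝ) : Measurable (weightChange q) := by
  unfold weightChange
  fun_prop

theorem measurable_updateWeights (hloss : Measurable (Function.uncurry cfg.loss)) {Y : Type*}
    [MeasurableSpace Y] {S : Y → Fin N → Sample} {Θ : Y → Param} {w : Y → Fin N → ℝ}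
    (hS : Measurable S) (hΘ : Measurable Θ) (hw : Measurable w) :
    Measurable fun y => updateWeights cfg (S y) (Θ y) (w y) := by
  have hnum : ∀ n, Measurable fun y => w y n * Real.exp
      (-(weightChange cfg.q (difficulty cfg (S y) (Θ y) (w y)) * beta cfg (Θ y) (S y n))) :=
    fun n => (measurable_pi_iff.1 hw n).mul (((measurable_weightChange cfg.q).comp
      (measurable_difficulty hloss hS hΘ hw)).mul
        (measurable_beta hloss hΘ (measurable_pi_iff.1 hS n))).neg.exp
  exact measurable_pi_iff.2 fun n => (hnum n).div (Finset.measurable_sum _ fun i _ => hnum i)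

theorem measurable_weights (hloss : Measurable (Function.uncurry cfg.loss)) (k : ℕ) :
    Measurable fun p : (Fin N → Sample) × (ℕ → Param) => weights cfg p.1 p.2 k := by
  induction k with
  | zero => exact measurable_const
  | succ k ih =>
    exact measurable_updateWeights hloss measurable_fst
      (measurable_pi_iff.1 measurable_snd (k + 1)) ih

theorem measurable_rho (hloss : Measurable (Function.uncurry cfg.loss)) (k : ℕ) :
    Measurable fun p : (Fin N → Sample) × (ℕ → Param) => rho cfg p.1 p.2 k :=
  measurable_difficulty hloss measurable_fst (measurable_pi_iff.1 measurable_snd k)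
    (measurable_weights hloss (k - 1))

theorem measurable_alpha (hloss : Measurable (Function.uncurry cfg.loss)) (k : ℕ) :
    Measurable fun p : (Fin N → Sample) × (ℕ → Param) => alpha cfg p.1 p.2 k :=
  (measurable_weightChange cfg.q).comp (measurable_rho hloss k)

theorem measurable_partialMargin (hloss : Measurable (Function.uncurry cfg.loss)) (K Δ : ℕ) :
    Measurable (Function.uncurry fun p : (Fin N → Sample) × (ℕ → Param) =>
      partialMargin cfg p.1 p.2 K Δ) := by
  have hα : ∀ k, Measurable fun y : ((Fin N → Sample) × (ℕ → Param)) × Sample =>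
      alpha cfg y.1.1 y.1.2 k := fun k => (measurable_alpha hloss k).comp measurable_fst
  have hA : ∀ L, Measurable fun y : ((Fin N → Sample) × (ℕ → Param)) × Sample =>
      cumAlpha cfg y.1.1 y.1.2 L := fun L => Finset.measurable_sum _ fun k _ => hα k
  have hg : ∀ L, Measurable fun y : ((Fin N → Sample) × (ℕ → Param)) × Sample =>
      cumPerf cfg y.1.1 y.1.2 L y.2 := fun L => Finset.measurable_sum _ fun k _ =>
    (hα k).mul (measurable_beta hloss (measurable_pi_iff.1 measurable_fst.snd k) measurable_snd)
  -- Real division is total, so measurability needs no nonzero denominator.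
  exact ((hg _).sub (hg _)).div ((hA _).sub (hA _))

theorem measurableSet_admissibleRuns (hloss : Measurable (Function.uncurry cfg.loss))
    {W : Set Param} (hW : MeasurableSet W) (N K Δ : ℕ) :
    MeasurableSet (admissibleRuns cfg W N K Δ) := by
  have h1 : MeasurableSet {p : (Fin N → Sample) × (ℕ → Param) | ∀ k, p.2 k ∈ W} :=
    measurableSet_setOfPred.2 <| Measurable.forall fun k =>
      measurableSet_setOfPred.1 (measurable_pi_iff.1 measurable_snd k hW)
  have hρ : ∀ k, Measurable fun p : (Fin N → Sample) × (ℕ → Param) => rho cfg p.1 p.2 k :=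
    measurable_rho hloss
  have h2 : MeasurableSet {p : (Fin N → Sample) × (ℕ → Param) |
      ∀ k ∈ Finset.Icc 1 (K + Δ), 0 < rho cfg p.1 p.2 k ∧ rho cfg p.1 p.2 k < 1} := by
    have : {p : (Fin N → Sample) × (ℕ → Param) |
        ∀ k ∈ Finset.Icc 1 (K + Δ), 0 < rho cfg p.1 p.2 k ∧ rho cfg p.1 p.2 k < 1} =
        ⋂ k ∈ Finset.Icc 1 (K + Δ), (fun p => rho cfg p.1 p.2 k) ⁻¹' Set.Ioo 0 1 := by
      ext p; simp
    rw [this]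
    exact Finset.measurableSet_biInter _ fun k _ => hρ k measurableSet_Ioo
  have h3 : MeasurableSet {p : (Fin N → Sample) × (ℕ → Param) |
      IsConvergencePhase cfg p.1 p.2 K Δ} := by
    have : {p : (Fin N → Sample) × (ℕ → Param) | IsConvergencePhase cfg p.1 p.2 K Δ} =
        ⋂ k ∈ Finset.Icc (K + 1) (K + Δ), (fun p => rho cfg p.1 p.2 k) ⁻¹' Set.Iio (1 / 2) := by
      ext p; simp [IsConvergencePhase]
    rw [this]
    exact Finset.measurableSet_biInter _ fun k _ => hρ k measurableSet_Iio
  exact h1.inter (h2.inter h3)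

end APW

theorem theorem4 {Param Sample : Type*} [MeasurableSpace Param] [StandardBorelSpace Param]
    [MeasurableSpace Sample] [StandardBorelSpace Sample]
    (cfg : APW.Config Param Sample)
    (hloss : Measurable (Function.uncurry cfg.loss))
    (hq : 2 ≤ cfg.q) (hc0 : 0 ≤ cfg.c) (hc1 : cfg.c < 1 / 2)
    (W : Set Param) (hW : MeasurableSet W)
    (D : Measure Sample) [IsProbabilityMeasure D]
    (N K Δ : ℕ) (hN : 0 < N) (hΔ : 0 < Δ)
    (ε θ : ℝ) (hε : 0 < ε) (hθ : 0 < θ) :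
    ∃ E : Set (Fin N → Sample), MeasurableSet E ∧
      1 - 2 * ((sloppyCoveringNumber (APW.marginClass cfg W N K Δ) (θ / 2) (ε / 8) (2 * N) : ℕ∞) :
          ℝ≥0∞) * ENNReal.ofReal (Real.exp (-(ε ^ 2 * N / 32)))
        ≤ Measure.pi (fun _ : Fin N => D) E ∧
      ∀ S ∈ E, ∀ b ∈ APW.marginClass cfg W N K Δ,
        D.real {z | b z ≤ 0} ≤ empProb S {z | b z ≤ θ} + ε := by
  rw [APW.marginClass_eq_image]
  exact exists_measurableSet_margin_bound (APW.measurable_partialMargin hloss K Δ)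
    (APW.measurableSet_admissibleRuns hloss hW N K Δ) D hN hε
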